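/- A game graph consists of a finite non-empty set $V$ of $n$ states, partitioned into the states $V_0$ of player 0 and the states $V_1$ of player 1, a transition relation $E\subseteq V\times V$ such that every state has a successor, and a labeling $L$ of the states by sets of atomic propositions. For $S\subseteq V$ let $$\mathrm{Pre}(S)=\{v\in V_0: \exists v'\in S,\ (v,v')\in E\}\cup\{v\in V_1:\forall v',\ (v,v')\in E\Rightarrow v'\in S\}.$$ A mode-target game is a game graph with atomic propositions $M_1,\dots,M_m$ (modes) and $T_{i,1},\dots,T_{i,t_i}$, $t_i\ge 1$ (the targets of mode $i$), in which no state is labeled with two different modes ($M_i\in L(v)$ implies $M_j\notin L(v)$ for $j\neq i$), with the LTL winning condition for player 0 $$\varphi=\bigwedge_{i=1}^m\Bigl(\Diamond\square M_i\implies\bigvee_{j=1}^{t_i}\Diamond\square T_{i,j}\Bigr).$$ Let $[\![\varphi]\!]$ be the set of states from which player 0 has a winning strategy, and for a Boolean combination $p$ of atomic propositions let $[\![p]\!]$ be the set of states whose label satisfies $p$. For monotone $F:2^V\to 2^V$ let $\nu X\,F(X)=\bigcap_k F^k(V)$ and $\mu X\,F(X)=\bigcup_k F^k(\varnothing)$.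 The algorithm MT evaluates the fixed-point expression $$\nu Z\ \bigcap_{i=1}^m\ \mu Y\ \bigcup_{j=1}^{t_i}\ \nu X\ \Bigl[(\mathrm{Pre}(X)\cap[\![M_i\wedge T_{i,j}]\!])\cup([\![\neg M_i]\!]\cap\mathrm{Pre}(Z))\cup\mathrm{Pre}(Y)\Bigr]\qquad(*)$$ (the scope of $\nu X$ is the whole bracket) by nested iteration, each iteration running until its set no longer changes: $Z$ starts from $V$, $Y$ starts from $\varnothing$ for each $Z$ and $i$, and the iteration in $X$ for mode $i$ and target $j$ in the $l$-th round of the iteration in $Y$ starts from the value obtained the last time that the same $(i,j,l)$ was reached, during an earlier round of the iteration in $Z$, or from $V$ if there is none (the evaluation method of Browne et al. that reuses intermediate values). Theorem. MT solves mode-target games with $O\bigl(\sum_{i=1}^m t_i\,n^2\bigr)$ computations of $\mathrm{Pre}$. That is, there is an absolute constant $C$ such that for every mode-target game the set $[\![\varphi]\!]$ equals $(*)$, and MT halts, returns $[\![\varphi]\!]$, and performs at most $C\sum_{i=1}^m t_i\,n^2$ computations of $\mathrm{Pre}$. -/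

import Mathlib

universe u v

namespace MTG

/-! ### Linear temporal logic -/

/-- LTL formulas over the atomic propositions `P`. The constant `tru` is primitive, so that it
is available (as the value of an empty conjunction) even if there are no atomic propositions. -/
inductive LTL (P : Type v) : Type v
  | tru : LTL P
  | atom : P → LTL P
  | neg : LTL P → LTL P
  | or : LTL P → LTL P → LTL P
  | next : LTL P → LTL P
  | untl : LTL P → LTL P → LTL P

namespace LTL

variable {P : Type v}

/-- `Sat w i φ`: the infinite word `w` over the alphabet of sets of atomic propositions
satisfies `φ` at time `i`. -/
def Sat (w : ℕ → Set P) : ℕ → LTL P → Prop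
  | _, tru => True
  | i, atom p => p ∈ w i
  | i, neg φ => ¬ Sat w i φ
  | i, or φ ψ => Sat w i φ ∨ Sat w i ψ
  | i, next φ => Sat w (i + 1) φ
  | i, untl φ ψ => ∃ k, i ≤ k ∧ Sat w k ψ ∧ ∀ j, i ≤ j → j < k → Sat w j φ

/-- Conjunction. -/
def and (φ ψ : LTL P) : LTL P := neg (or (neg φ) (neg ψ))

/-- Implication. -/
def imp (φ ψ : LTL P) : LTL P := or (neg φ) ψ

/-- Eventually. -/
def ev (φ : LTL P) : LTL P := untl tru φ

/-- Always. -/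
def alw (φ : LTL P) : LTL P := neg (ev (neg φ))

/-- Finite conjunction. -/
def bigAnd (l : List (LTL P)) : LTL P := l.foldr and tru

/-- Finite disjunction. -/
def bigOr (l : List (LTL P)) : LTL P := l.foldr or (neg tru)

end LTL

/-! ### Games -/

/-- A game graph with states `V` (taken finite in the theorem) and atomic propositions `P`.
Player 0 moves from the states in `V₀`, player 1 from those in `V₁`. -/
structure GameGraph (V : Type u) (P : Type v) where
  V₀ : Set V
  V₁ : Set V
  cover : V₀ ∪ V₁ = Set.univ
  disjoint : V₀ ∩ V₁ = ∅
  /-- The transition relation. -/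
  E : V → V → Prop
  /-- The labeling function. -/
  L : V → Set P
  serial : ∀ v, ∃ v', E v v'

namespace GameGraph

variable {V : Type u} {P : Type v} (G : GameGraph V P)

/-- An infinite sequence of states is a play if it runs along transitions. -/
def IsPlay (r : ℕ → V) : Prop := ∀ k, G.E (r k) (r (k + 1))

/-- A strategy of player 0: a partial function of the history (the list of the earlier states)
and of the current state, which is a state of player 0. -/
structure Strategy where
  move : List V → G.V₀ → Option V
  legal : ∀ (h : List V) (x : G.V₀) (y : V), move h x = some y → G.E x y

/-- A play follows a strategy if every move of player 0 at which the strategy is defined is the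
move that the strategy prescribes. Where the strategy is undefined every transition is allowed
(so being undefined never makes a strategy win for want of plays). -/
def Follows (f : G.Strategy) (r : ℕ → V) : Prop :=
  ∀ (k : ℕ) (h : r k ∈ G.V₀) (y : V),
    f.move ((List.range k).map r) ⟨r k, h⟩ = some y → r (k + 1) = y

/-- The set of states from which player 0 has a winning strategy for the condition `φ`. -/
def winningSet (φ : LTL P) : Set V :=
  {x | ∃ f : G.Strategy, ∀ r : ℕ → V, G.IsPlay r → r 0 = x → G.Follows f r →
    LTL.Sat (fun k => G.L (r k)) 0 φ}

/-- The states from which player 0 can force the next state to be in `S`. -/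
def Pre (S : Set V) : Set V :=
  {x | x ∈ G.V₀ ∧ ∃ y ∈ S, G.E x y} ∪ {x | x ∈ G.V₁ ∧ ∀ y, G.E x y → y ∈ S}

end GameGraph

/-- A game graph labeled with `m` mutually exclusive modes `M i` and with `t i` targets
`T i j` of mode `i`. -/
structure ModeTargetGame (V : Type u) (P : Type v) (m : ℕ) (t : Fin m → ℕ)
    extends GameGraph V P where
  M : Fin m → P
  T : (i : Fin m) → Fin (t i) → P
  exclusive : ∀ (x : V) (i j : Fin m), j ≠ i → M i ∈ L x → M j ∉ L x

/-! ### Fixed points by iteration -/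

/-- `ν X. F X`, the intersection of the iterates of `F` from the full set. -/
def nuFix {V : Type u} (F : Set V → Set V) : Set V := ⋂ k : ℕ, F^[k] Set.univ

/-- `μ X. F X`, the union of the iterates of `F` from the empty set. -/
def muFix {V : Type u} (F : Set V → Set V) : Set V := ⋃ k : ℕ, F^[k] ∅

/-! ### Symbolic computations and their number of `Pre` computations -/

/-- The outcome of a symbolic computation whose loops have a bounded budget of rounds:
`none` if some loop ran out of its budget, and `some (a, c)` if the computation returned `a`
after `c` computations of `Pre`. -/
def Symb (α : Type u) : Type u := Option (α × ℕ)

namespace Symb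

/-- Some loop ran out of its budget. -/
def outOfBudget {α : Type u} : Symb α := (none : Option (α × ℕ))

/-- A result that was obtained with `c` computations of `Pre`. -/
def result {α : Type u} (a : α) (c : ℕ) : Symb α := some (a, c)

/-- Sequencing adds the costs; steps other than `Pre` are free. -/
instance : Monad Symb.{u} where
  pure a := result a 0
  bind x f :=
    match x with
    | none => none
    | some (a, c) =>
      match f a with
      | none => none
      | some (b, d) => some (b, c + d)

/-- The computation `prog`, whose argument is the budget of its loops, halts with output `a`
after exactly `c` computations of `Pre`: the loops end by themselves once the budget is large,
and then the outcome no longer depends on it. -/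
def HaltsWith {α : Type u} (prog : ℕ → Symb α) (a : α) (c : ℕ) : Prop :=
  ∃ N₀, ∀ N, N₀ ≤ N → prog N = result a c

end Symb

/-! ### The symbolic algorithm

In the nested iteration, every greatest fixed point in `X` is started from the value that was
computed last for the same mode `i`, the same target `j` and the same number `l` of the round
of the `Y`-iteration, during an earlier round of the `Z`-iteration, or from the full
set if there is none. This is the evaluation of nested fixed points of Browne, Clarke, Jha, Long
and Marrero. The algorithm has access to the transitions only through its argument `pre`. -/

section Algorithm

variable {V : Type u}

open Classical in
/-- Replace `X` by `step X` until `X` no longer changes. -/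
noncomputable def untilStable (step : Set V → Symb (Set V)) : ℕ → Set V → Symb (Set V)
  | 0, _ => Symb.outOfBudget
  | b + 1, X => do
    let X' ← step X
    if X' = X then return X else untilStable step b X'

/-- One pass over the `t` targets of a mode, in round `l` of the iteration in `Y`: compute
`ν X. (Pre X ∩ A j) ∪ B` for all targets `j`, starting from the stored sets `s j l`, which are
overwritten with the results, and return the union of the results. -/
noncomputable def targetPass (N : ℕ) (pre : Set V → Symb (Set V)) {t : ℕ} (A : Fin t → Set V)
    (B : Set V) (l : ℕ) (s : Fin t → ℕ → Set V) : Symb (Set V × (Fin t → ℕ → Set V)) :=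
  (List.finRange t).foldlM
    (fun (acc : Set V × (Fin t → ℕ → Set V)) j => do
      let X ← untilStable (fun X => do return ((← pre X) ∩ A j) ∪ B) N (acc.2 j l)
      return (acc.1 ∪ X, Function.update acc.2 j (Function.update (acc.2 j) l X)))
    (∅, s)

open Classical in
/-- The iteration for `μ Y. ⋃ j, ν X. (Pre X ∩ A j) ∪ B ∪ Pre Y`, from round `l` with the current
set `Y` on, until `Y` no longer changes. -/
noncomputable def yLoop (N : ℕ) (pre : Set V → Symb (Set V)) {t : ℕ} (A : Fin t → Set V)
    (B : Set V) :
    ℕ → ℕ → Set V → (Fin t → ℕ → Set V) → Symb (Set V × (Fin t → ℕ → Set V))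
  | 0, _, _, _ => Symb.outOfBudget
  | b + 1, l, Y, s => do
    let preY ← pre Y
    let out ← targetPass N pre A (B ∪ preY) l s
    if out.1 = Y then return (Y, out.2) else yLoop N pre A B b (l + 1) out.1 out.2

/-- One pass over the `m` modes: compute
`μ Y. ⋃ j, ν X. (Pre X ∩ A i j) ∪ (D i ∩ Pre Z) ∪ Pre Y` for all modes `i`, and return the
intersection of the results. -/
noncomputable def modePass (N : ℕ) (pre : Set V → Symb (Set V)) {m : ℕ} {t : Fin m → ℕ}
    (A : (i : Fin m) → Fin (t i) → Set V) (D : Fin m → Set V) (Z : Set V)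
    (s : (i : Fin m) → Fin (t i) → ℕ → Set V) :
    Symb (Set V × ((i : Fin m) → Fin (t i) → ℕ → Set V)) :=
  (List.finRange m).foldlM
    (fun (acc : Set V × ((i : Fin m) → Fin (t i) → ℕ → Set V)) i => do
      let preZ ← pre Z
      let out ← yLoop N pre (A i) (D i ∩ preZ) N 0 ∅ (acc.2 i)
      return (acc.1 ∩ out.1, Function.update acc.2 i out.2))
    (Set.univ, s)

open Classical in
/-- The iteration in `Z`, from the current set `Z` on, until `Z` no longer changes. -/
noncomputable def zLoop (N : ℕ) (pre : Set V → Symb (Set V)) {m : ℕ} {t : Fin m → ℕ}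
    (A : (i : Fin m) → Fin (t i) → Set V) (D : Fin m → Set V) :
    ℕ → Set V → ((i : Fin m) → Fin (t i) → ℕ → Set V) → Symb (Set V)
  | 0, _, _ => Symb.outOfBudget
  | b + 1, Z, s => do
    let out ← modePass N pre A D Z s
    if out.1 = Z then return Z else zLoop N pre A D b out.1 out.2

/-- The whole algorithm: all stored sets and `Z` start as the full set. -/
noncomputable def algorithmMT (pre : Set V → Symb (Set V)) {m : ℕ} {t : Fin m → ℕ}
    (A : (i : Fin m) → Fin (t i) → Set V) (D : Fin m → Set V) (N : ℕ) : Symb (Set V) :=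
  zLoop N pre A D N Set.univ (fun _ _ _ => Set.univ)

end Algorithm

namespace ModeTargetGame

variable {V : Type u} {P : Type v} {m : ℕ} {t : Fin m → ℕ} (G : ModeTargetGame V P m t)

/-- The mode-target formula `⋀ i, (◇□ M i → ⋁ j, ◇□ T i j)`. -/
def formula : LTL P :=
  LTL.bigAnd (List.ofFn fun i : Fin m =>
    LTL.imp (LTL.ev (LTL.alw (LTL.atom (G.M i))))
      (LTL.bigOr (List.ofFn fun j : Fin (t i) => LTL.ev (LTL.alw (LTL.atom (G.T i j))))))

/-- The states that satisfy the positional formula `M i ∧ T i j`. -/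
def modeTarget (i : Fin m) (j : Fin (t i)) : Set V := {x | G.M i ∈ G.L x ∧ G.T i j ∈ G.L x}

/-- The states that satisfy the positional formula `¬ M i`. -/
def notMode (i : Fin m) : Set V := {x | G.M i ∉ G.L x}

/-- `ν Z. ⋂ i, μ Y. ⋃ j, ν X. (Pre X ∩ ⟦M i ∧ T i j⟧) ∪ (⟦¬ M i⟧ ∩ Pre Z) ∪ Pre Y`. -/
def fixedPoint : Set V :=
  nuFix fun Z => ⋂ i : Fin m, muFix fun Y => ⋃ j : Fin (t i), nuFix fun X =>
    (G.Pre X ∩ G.modeTarget i j) ∪ (G.notMode i ∩ G.Pre Z) ∪ G.Pre Y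

/-- The algorithm run on a mode-target game, where every call of `Pre` costs one unit. -/
noncomputable def runMT : ℕ → Symb (Set V) :=
  algorithmMT (fun S => Symb.result (G.Pre S) 1) G.modeTarget G.notMode

end ModeTargetGame

end MTG

namespace MTG

/-! ### Fixed points on finite types -/

section FixedPoints

variable {V : Type u} {F G : Set V → Set V}

/-! Correctness. Let `Z` be the greatest fixed point, and for each mode let `Y` be the inner least
fixed point computed from `Z`. Mutual exclusion of the modes makes every one of these `Y` equal to
`Z` (`modeFix_subset_fixedPoint`). Player 0 wins from `Z` with a positional strategy. For each mode,
`Z` is exhausted by layers, each tied to one target (`exists_layers`). While the play is in mode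
`i`, player 0 either moves to a lower layer of that mode, or is in the target of the current layer
and does not rise. If the mode lasts forever, the layer stabilizes and its target holds from then
on. Conversely, the winning set `W` satisfies `W ⊆ zStep W`, so it lies in the greatest fixed point.
Outside the set of mode `i`, against any strategy, some play stays outside and, while in mode `i`,
leaves every target again and again in cyclic order (`exists_play_avoiding`). Either it remains in
mode `i` and violates the formula, or it leaves the mode at a state outside `Pre W`, and so can step
out of `W` and be continued by a losing play.

Cost. The argument is amortized, the potential being the total size of the stored sets. As `Z`
shrinks, so do the fixed points in `X`, hence old values remain legitimate starting points
(`StoreValid.anti`). A loop in `X` costs the number of states it removes from its stored set plus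
one at most. The removals total at most `∑ t i * (n + 1) * n`, and the remaining unit costs are
bounded by counting the at most `n + 1` rounds in `Z` and in each loop in `Y`. -/

theorem nuFix_mono (hF : Monotone F) (h : ∀ X, F X ⊆ G X) : nuFix F ⊆ nuFix G := by
  refine Set.iInter_mono fun k => ?_
  induction k with
  | zero => exact subset_rfl
  | succ k ih =>
    rw [Function.iterate_succ_apply', Function.iterate_succ_apply']
    exact (hF ih).trans (h _)

theorem muFix_mono (hF : Monotone F) (h : ∀ X, F X ⊆ G X) : muFix F ⊆ muFix G := by
  refine Set.iUnion_mono fun k => ?_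
  induction k with
  | zero => exact subset_rfl
  | succ k ih =>
    rw [Function.iterate_succ_apply', Function.iterate_succ_apply']
    exact (hF ih).trans (h _)

theorem subset_iterate_univ (hF : Monotone F) {X : Set V} (h : X ⊆ F X) (k : ℕ) :
    X ⊆ F^[k] Set.univ := by
  induction k with
  | zero => exact Set.subset_univ _
  | succ k ih =>
    rw [Function.iterate_succ_apply']
    exact h.trans (hF ih)

theorem iterate_empty_subset (hF : Monotone F) {X : Set V} (h : F X ⊆ X) (k : ℕ) :
    F^[k] ∅ ⊆ X := by
  induction k with
  | zero => exact Set.empty_subset _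
  | succ k ih =>
    rw [Function.iterate_succ_apply']
    exact (hF ih).trans h

theorem subset_nuFix (hF : Monotone F) {X : Set V} (h : X ⊆ F X) : X ⊆ nuFix F :=
  Set.subset_iInter fun k => subset_iterate_univ hF h k

theorem muFix_subset (hF : Monotone F) {X : Set V} (h : F X ⊆ X) : muFix F ⊆ X :=
  Set.iUnion_subset fun k => iterate_empty_subset hF h k

/-- The iterates decrease, and by pigeonhole two of them coincide; everything between them is then
constant, so the intersection is already attained at a finite stage. -/
theorem map_nuFix [Finite V] (hF : Monotone F) : F (nuFix F) = nuFix F := by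
  have hanti : Antitone fun k => F^[k] (Set.univ : Set V) :=
    hF.antitone_iterate_of_map_le (Set.subset_univ _)
  obtain ⟨a, b, hne, heq⟩ :=
    Finite.exists_ne_map_eq_of_infinite fun k => F^[k] (Set.univ : Set V)
  wlog hab : a < b generalizing a b
  · exact this b a hne.symm heq.symm (lt_of_le_of_ne (not_lt.mp hab) hne.symm)
  have hfix : F (F^[a] Set.univ) = F^[a] Set.univ := by
    rw [← Function.iterate_succ_apply' F]
    refine subset_antisymm (hanti (Nat.le_succ a)) ?_
    exact (show F^[a] Set.univ = F^[b] Set.univ from heq).le.trans (hanti hab)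
  have : nuFix F = F^[a] Set.univ :=
    subset_antisymm (Set.iInter_subset _ a) (subset_nuFix hF hfix.ge)
  rw [this, hfix]

theorem map_muFix [Finite V] (hF : Monotone F) : F (muFix F) = muFix F := by
  have hmono : Monotone fun k => F^[k] (∅ : Set V) :=
    hF.monotone_iterate_of_le_map (Set.empty_subset _)
  obtain ⟨a, b, hne, heq⟩ :=
    Finite.exists_ne_map_eq_of_infinite fun k => F^[k] (∅ : Set V)
  wlog hab : a < b generalizing a b
  · exact this b a hne.symm heq.symm (lt_of_le_of_ne (not_lt.mp hab) hne.symm)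
  have hfix : F (F^[a] ∅) = F^[a] ∅ := by
    rw [← Function.iterate_succ_apply' F]
    refine subset_antisymm ?_ (hmono (Nat.le_succ a))
    exact (hmono hab).trans (show F^[a] ∅ = F^[b] ∅ from heq).ge
  have : muFix F = F^[a] ∅ :=
    subset_antisymm (muFix_subset hF hfix.le) (Set.subset_iUnion (fun k => F^[k] ∅) a)
  rw [this, hfix]

end FixedPoints

/-! ### The operators of the mode-target fixed point -/

section Operators

variable {V : Type u}

/-- The operator `X ↦ (pre X ∩ A) ∪ B ∪ pre Y`. -/
def xStep (pre : Set V → Set V) (A B Y X : Set V) : Set V := (pre X ∩ A) ∪ (B ∪ pre Y)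

/-- The operator `Y ↦ ⋃ j, ν X. (pre X ∩ A j) ∪ B ∪ pre Y`. -/
def yStep (pre : Set V → Set V) {t : ℕ} (A : Fin t → Set V) (B Y : Set V) : Set V :=
  ⋃ j, nuFix (xStep pre (A j) B Y)

/-- The set `μ Y. ⋃ j, ν X. (pre X ∩ A j) ∪ B ∪ pre Y`. -/
def modeFix (pre : Set V → Set V) {t : ℕ} (A : Fin t → Set V) (B : Set V) : Set V :=
  muFix (yStep pre A B)

/-- The operator `Z ↦ ⋂ i, μ Y. ⋃ j, ν X. (pre X ∩ A i j) ∪ (D i ∩ pre Z) ∪ pre Y`. -/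
def zStep (pre : Set V → Set V) {m : ℕ} {t : Fin m → ℕ} (A : (i : Fin m) → Fin (t i) → Set V)
    (D : Fin m → Set V) (Z : Set V) : Set V :=
  ⋂ i, modeFix pre (A i) (D i ∩ pre Z)

variable {pre : Set V → Set V} {t : ℕ} {A : Fin t → Set V}

theorem xStep_subset (hpre : Monotone pre) (A : Set V) {B B' Y Y' X X' : Set V} (hB : B ⊆ B')
    (hY : Y ⊆ Y') (hX : X ⊆ X') : xStep pre A B Y X ⊆ xStep pre A B' Y' X' :=
  Set.union_subset_union (Set.inter_subset_inter_left _ (hpre hX))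
    (Set.union_subset_union hB (hpre hY))

theorem monotone_xStep (hpre : Monotone pre) (A B Y : Set V) : Monotone (xStep pre A B Y) :=
  fun _ _ h => xStep_subset hpre A subset_rfl subset_rfl h

theorem nuFix_xStep_subset (hpre : Monotone pre) (A : Set V) {B B' Y Y' : Set V} (hB : B ⊆ B')
    (hY : Y ⊆ Y') : nuFix (xStep pre A B Y) ⊆ nuFix (xStep pre A B' Y') :=
  nuFix_mono (monotone_xStep hpre A B Y) fun _ => xStep_subset hpre A hB hY subset_rfl

theorem yStep_subset (hpre : Monotone pre) {B B' Y Y' : Set V} (hB : B ⊆ B')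
    (hY : Y ⊆ Y') : yStep pre A B Y ⊆ yStep pre A B' Y' :=
  Set.iUnion_mono fun j => nuFix_xStep_subset hpre (A j) hB hY

theorem monotone_yStep (hpre : Monotone pre) (B : Set V) : Monotone (yStep pre A B) :=
  fun _ _ h => yStep_subset hpre subset_rfl h

theorem iterate_yStep_subset (hpre : Monotone pre) {B B' : Set V} (hB : B ⊆ B') (l : ℕ) :
    (yStep pre A B)^[l] ∅ ⊆ (yStep pre A B')^[l] ∅ := by
  induction l with
  | zero => exact subset_rfl
  | succ l ih =>
    rw [Function.iterate_succ_apply', Function.iterate_succ_apply']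
    exact yStep_subset hpre hB ih

theorem monotone_iterate_yStep (hpre : Monotone pre) (B : Set V) :
    Monotone fun l => (yStep pre A B)^[l] ∅ :=
  (monotone_yStep hpre B).monotone_iterate_of_le_map (Set.empty_subset _)

theorem modeFix_subset (hpre : Monotone pre) {B B' : Set V} (hB : B ⊆ B') :
    modeFix pre A B ⊆ modeFix pre A B' :=
  muFix_mono (monotone_yStep hpre B) fun _ => yStep_subset hpre hB subset_rfl

theorem monotone_zStep (hpre : Monotone pre) {m : ℕ} {t : Fin m → ℕ}
    (A : (i : Fin m) → Fin (t i) → Set V) (D : Fin m → Set V) : Monotone (zStep pre A D) :=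
  fun _ _ h => Set.iInter_mono fun _ =>
    modeFix_subset hpre (Set.inter_subset_inter_right _ (hpre h))

theorem iterate_yStep_subset_modeFix (B : Set V) (l : ℕ) :
    (yStep pre A B)^[l] ∅ ⊆ modeFix pre A B :=
  Set.subset_iUnion (fun l => (yStep pre A B)^[l] ∅) l

variable [Finite V]

theorem yStep_modeFix (hpre : Monotone pre) (B : Set V) :
    yStep pre A B (modeFix pre A B) = modeFix pre A B :=
  map_muFix (monotone_yStep hpre B)

theorem xStep_nuFix (hpre : Monotone pre) (A B Y : Set V) :
    xStep pre A B Y (nuFix (xStep pre A B Y)) = nuFix (xStep pre A B Y) :=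
  map_nuFix (monotone_xStep hpre A B Y)

theorem subset_nuFix_xStep (hpre : Monotone pre) (A B Y : Set V) :
    B ∪ pre Y ⊆ nuFix (xStep pre A B Y) := by
  rw [← xStep_nuFix hpre]
  exact Set.subset_union_right

/-- Every operator in `X` has `B ∪ pre Y` as a summand, so one target is enough; without any, the
union over targets would be empty. -/
theorem union_pre_subset_modeFix (hpre : Monotone pre) (ht : 1 ≤ t) (B : Set V) :
    B ∪ pre (modeFix pre A B) ⊆ modeFix pre A B := by
  conv_rhs => rw [← yStep_modeFix hpre]
  exact (subset_nuFix_xStep hpre (A ⟨0, ht⟩) B _).trans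
    (Set.subset_iUnion (fun j => nuFix (xStep pre (A j) B (modeFix pre A B))) _)

/-- A state of some fixed point in `X` enters by `B ∪ pre Y` or by `pre X ∩ A j`; since `X ⊆ Y` at
the fixed point, the latter also lies in `pre Y`. -/
theorem modeFix_subset_union_pre (hpre : Monotone pre) (B : Set V) :
    modeFix pre A B ⊆ B ∪ pre (modeFix pre A B) := by
  intro x hx
  have hx' := hx
  rw [← yStep_modeFix hpre] at hx'
  obtain ⟨j, hj⟩ := Set.mem_iUnion.mp hx'
  have hsub : nuFix (xStep pre (A j) B (modeFix pre A B)) ⊆ modeFix pre A B := by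
    conv_rhs => rw [← yStep_modeFix hpre]
    exact Set.subset_iUnion (fun j => nuFix (xStep pre (A j) B (modeFix pre A B))) j
  rw [← xStep_nuFix hpre] at hj
  rcases hj with h | h
  · exact Or.inr (hpre hsub h.1)
  · exact h

/-- At the fixed point in `Y`, every target yields the same set. -/
theorem nuFix_xStep_modeFix (hpre : Monotone pre) (B : Set V) (j : Fin t) :
    nuFix (xStep pre (A j) B (modeFix pre A B)) = modeFix pre A B := by
  apply subset_antisymm
  · conv_rhs => rw [← yStep_modeFix hpre]
    exact Set.subset_iUnion (fun j => nuFix (xStep pre (A j) B (modeFix pre A B))) j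
  · exact (modeFix_subset_union_pre hpre B).trans (subset_nuFix_xStep hpre _ _ _)

/-- The fixed point for one mode is exhausted by layers; from a layer one either stays in it,
in its target, or leaves to `B` or to a lower layer. -/
theorem exists_layers (hpre : Monotone pre) (ht : 1 ≤ t) (B : Set V) :
    ∃ (Q : ℕ → Set V) (τ : ℕ → Fin t), (⋃ k, Q k) = modeFix pre A B ∧
      ∀ k, Q k ⊆ (pre (Q k) ∩ A (τ k)) ∪ (B ∪ pre (⋃ k' < k, Q k')) := by
  -- The pairs (round `l`, target `j`) are enumerated lexicographically as `k = t * l + j`.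
  let τ : ℕ → Fin t := fun k => ⟨k % t, Nat.mod_lt _ ht⟩
  let Q : ℕ → Set V := fun k => nuFix (xStep pre (A (τ k)) B ((yStep pre A B)^[k / t] ∅))
  have hQ : ∀ (l : ℕ) (j : Fin t),
      Q (t * l + j) = nuFix (xStep pre (A j) B ((yStep pre A B)^[l] ∅)) := by
    intro l j
    have h1 : (t * l + j) / t = l := by
      rw [Nat.mul_add_div ht, Nat.div_eq_of_lt j.2, add_zero]
    have h2 : τ (t * l + j) = j := by
      apply Fin.ext
      simp [τ, Nat.mod_eq_of_lt j.2]
    simp only [Q, h1, h2]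
  have hsub : ∀ l, (yStep pre A B)^[l] ∅ ⊆ ⋃ k' < t * l, Q k' := by
    intro l x hx
    cases l with
    | zero => exact hx.elim
    | succ l =>
      rw [Function.iterate_succ_apply'] at hx
      obtain ⟨j, hj⟩ := Set.mem_iUnion.mp hx
      rw [← hQ] at hj
      refine Set.mem_iUnion₂.mpr ⟨t * l + j, ?_, hj⟩
      rw [Nat.mul_succ]
      exact Nat.add_lt_add_left j.2 _
  refine ⟨Q, τ, subset_antisymm (Set.iUnion_subset fun k x hx => ?_)
    (Set.iUnion_subset fun l x hx => ?_), fun k x hx => ?_⟩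
  · refine iterate_yStep_subset_modeFix B (k / t + 1) ?_
    rw [Function.iterate_succ_apply']
    exact Set.mem_iUnion.mpr ⟨τ k, hx⟩
  · obtain ⟨k, -, hk⟩ := Set.mem_iUnion₂.mp (hsub l hx)
    exact Set.mem_iUnion.mpr ⟨k, hk⟩
  · have hx' : x ∈ xStep pre (A (τ k)) B ((yStep pre A B)^[k / t] ∅) (Q k) := by
      rw [show Q k = _ from rfl, xStep_nuFix hpre]
      exact hx
    rcases hx' with h | h | h
    · exact Or.inl h
    · exact Or.inr (Or.inl h)
    -- The `Y`-iterate of round `k / t` is covered by the layers below `t * (k / t) ≤ k`.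
    · refine Or.inr (Or.inr (hpre ((hsub _).trans ?_) h))
      exact Set.biUnion_subset_biUnion_left fun k' hk' => lt_of_lt_of_le hk' (Nat.mul_div_le k t)

end Operators

end MTG

namespace MTG

/-! ### Semantics of the mode-target formula -/

namespace LTL

variable {P : Type v} (w : ℕ → Set P) (i : ℕ)

theorem sat_and (φ ψ : LTL P) : Sat w i (and φ ψ) ↔ Sat w i φ ∧ Sat w i ψ := by
  simp [and, Sat]

theorem sat_imp (φ ψ : LTL P) : Sat w i (imp φ ψ) ↔ (Sat w i φ → Sat w i ψ) := by
  simp [imp, Sat, imp_iff_not_or]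

theorem sat_bigAnd (l : List (LTL P)) : Sat w i (bigAnd l) ↔ ∀ φ ∈ l, Sat w i φ := by
  induction l with
  | nil => simp [bigAnd, Sat]
  | cons φ l ih =>
    rw [List.forall_mem_cons, ← ih]
    exact sat_and w i φ (bigAnd l)

theorem sat_bigOr (l : List (LTL P)) : Sat w i (bigOr l) ↔ ∃ φ ∈ l, Sat w i φ := by
  induction l with
  | nil => simp [bigOr, Sat]
  | cons φ l ih =>
    rw [List.exists_mem_cons_iff, ← ih]
    exact Iff.rfl

theorem sat_ev_alw_atom (p : P) :
    Sat w 0 (ev (alw (atom p))) ↔ ∃ k, ∀ j, k ≤ j → p ∈ w j := by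
  simp [ev, alw, Sat]

end LTL

/-! ### Plays and strategies -/

namespace GameGraph

variable {V : Type u} {P : Type v} (G : GameGraph V P)

theorem monotone_Pre : Monotone G.Pre := by
  rintro S S' h x (⟨hx, y, hy, hE⟩ | ⟨hx, hy⟩)
  · exact Or.inl ⟨hx, y, h hy, hE⟩
  · exact Or.inr ⟨hx, fun y hE => h (hy y hE)⟩

theorem mem_V₀_or_mem_V₁ (x : V) : x ∈ G.V₀ ∨ x ∈ G.V₁ := by
  have : x ∈ G.V₀ ∪ G.V₁ := G.cover ▸ Set.mem_univ x
  exact this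

theorem not_mem_V₁ {x : V} (h : x ∈ G.V₀) : x ∉ G.V₁ := fun h' => by
  have : x ∈ G.V₀ ∩ G.V₁ := ⟨h, h'⟩
  rw [G.disjoint] at this
  exact this

/-- If player 0 can force the next state from every state `x` of `W` into `S x ⊆ W`, then some
strategy does so in all plays from `W`. -/
theorem exists_positional (W : Set V) (S : V → Set V) (hS : ∀ x ∈ W, S x ⊆ W)
    (hW : ∀ x ∈ W, x ∈ G.Pre (S x)) :
    ∃ f : G.Strategy, ∀ r : ℕ → V, G.IsPlay r → r 0 ∈ W → G.Follows f r →
      ∀ k, r k ∈ W ∧ r (k + 1) ∈ S (r k) := by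
  classical
  have hex : ∀ x, x ∈ W → x ∈ G.V₀ → ∃ y ∈ S x, G.E x y := by
    intro x hx h₀
    rcases hW x hx with h | h
    · exact h.2
    · exact absurd h.1 (G.not_mem_V₁ h₀)
  let f : G.Strategy :=
    { move := fun _ x => if hx : x.1 ∈ W then some (hex x.1 hx x.2).choose else none
      legal := by
        intro _ x y hy
        by_cases hx : x.1 ∈ W
        · rw [dif_pos hx, Option.some.injEq] at hy
          exact hy ▸ (hex x.1 hx x.2).choose_spec.2
        · rw [dif_neg hx] at hy
          cases hy }
  refine ⟨f, fun r hr h0 hf => ?_⟩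
  have hnext : ∀ k, r k ∈ W → r (k + 1) ∈ S (r k) := by
    intro k hk
    rcases hW _ hk with h | h
    · have := hf k h.1 _ (dif_pos hk)
      rw [this]
      exact (hex _ hk h.1).choose_spec.1
    · exact h.2 _ (hr k)
  have hin : ∀ k, r k ∈ W := by
    intro k
    induction k with
    | zero => exact h0
    | succ k ih => exact hS _ ih (hnext k ih)
  exact fun k => ⟨hin k, hnext k (hin k)⟩

variable {G}

/-- The transition from `x` to `y` after the history `h` is compatible with the strategy `f`. -/
def Strategy.Allows (f : G.Strategy) (h : List V) (x y : V) : Prop :=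
  G.E x y ∧ ∀ (hx : x ∈ G.V₀) (z : V), f.move h ⟨x, hx⟩ = some z → y = z

/-- From a state from which player 0 cannot force `S`, every strategy of player 0 allows to
leave `S`. -/
theorem Strategy.exists_allows (f : G.Strategy) (h : List V) {x : V} {S : Set V}
    (hx : x ∉ G.Pre S) : ∃ y, y ∉ S ∧ f.Allows h x y := by
  rcases G.mem_V₀_or_mem_V₁ x with h₀ | h₁
  · have hS : ∀ y, G.E x y → y ∉ S := fun y hE hy => hx (Or.inl ⟨h₀, y, hy, hE⟩)
    cases hm : f.move h ⟨x, h₀⟩ with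
    | none =>
      obtain ⟨y, hy⟩ := G.serial x
      exact ⟨y, hS y hy, hy, fun _ z hz => by rw [hm] at hz; cases hz⟩
    | some y =>
      have hy := f.legal _ _ _ hm
      exact ⟨y, hS y hy, hy, fun _ z hz => by rw [hm] at hz; exact Option.some.inj hz⟩
  · have : ∃ y, G.E x y ∧ y ∉ S := by
      by_contra hno
      push Not at hno
      exact hx (Or.inr ⟨h₁, hno⟩)
    obtain ⟨y, hE, hy⟩ := this
    exact ⟨y, hy, hE, fun h₀ => absurd h₁ (G.not_mem_V₁ h₀)⟩

theorem Strategy.allows_of_follows {f : G.Strategy} {r : ℕ → V} (hr : G.IsPlay r)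
    (hf : G.Follows f r) (k : ℕ) : f.Allows ((List.range k).map r) (r k) (r (k + 1)) :=
  ⟨hr k, fun h z hz => hf k h z hz⟩

theorem Strategy.follows_of_allows {f : G.Strategy} {r : ℕ → V}
    (h : ∀ k, f.Allows ((List.range k).map r) (r k) (r (k + 1))) :
    G.IsPlay r ∧ G.Follows f r :=
  ⟨fun k => (h k).1, fun k hk y hy => (h k).2 hk y hy⟩

/-- A play with memory in `Q` can be built step by step against a strategy. -/
theorem Strategy.exists_play (f : G.Strategy) {Q : Type*} (I : V → Q → Prop)
    (R : V → Q → V → Q → Prop)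
    (step : ∀ (h : List V) (x : V) (q : Q), I x q → ∃ y q', f.Allows h x y ∧ I y q' ∧ R x q y q')
    (x : V) (q : Q) (hx : I x q) :
    ∃ (r : ℕ → V) (p : ℕ → Q), G.IsPlay r ∧ G.Follows f r ∧ r 0 = x ∧ p 0 = q ∧
      ∀ k, I (r k) (p k) ∧ R (r k) (p k) (r (k + 1)) (p (k + 1)) := by
  choose ny nq hny using step
  -- The recursion carries the history, because the strategy may depend on it.
  let σ : ℕ → List V × {a : V × Q // I a.1 a.2} := fun k =>
    Nat.rec ([], ⟨(x, q), hx⟩) (fun _ a =>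
      (a.1 ++ [a.2.1.1],
        ⟨(ny a.1 a.2.1.1 a.2.1.2 a.2.2, nq a.1 a.2.1.1 a.2.1.2 a.2.2),
          (hny a.1 a.2.1.1 a.2.1.2 a.2.2).2.1⟩)) k
  have hhist : ∀ k, (σ k).1 = (List.range k).map fun k => (σ k).2.1.1 := by
    intro k
    induction k with
    | zero => rfl
    | succ k ih =>
      rw [List.range_succ, List.map_append, ← ih]
      rfl
  have hall : ∀ k, f.Allows ((List.range k).map fun k => (σ k).2.1.1) (σ k).2.1.1
      (σ (k + 1)).2.1.1 := by
    intro k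
    rw [← hhist k]
    exact (hny (σ k).1 (σ k).2.1.1 (σ k).2.1.2 (σ k).2.2).1
  obtain ⟨h1, h2⟩ := Strategy.follows_of_allows hall
  exact ⟨fun k => (σ k).2.1.1, fun k => (σ k).2.1.2, h1, h2, rfl, rfl, fun k =>
    ⟨(σ k).2.2, (hny (σ k).1 (σ k).2.1.1 (σ k).2.1.2 (σ k).2.2).2.2⟩⟩

/-- The strategy `f` after the history `h`. -/
def Strategy.after (f : G.Strategy) (h : List V) : G.Strategy where
  move h' x := f.move (h ++ h') x
  legal h' x y hy := f.legal (h ++ h') x y hy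

/-- A play against `f` may be continued by a play against the rest of `f`. -/
theorem Strategy.exists_append {f : G.Strategy} {r r' : ℕ → V} {k : ℕ}
    (hr : ∀ l < k, f.Allows ((List.range l).map r) (r l) (r (l + 1)))
    (hk : f.Allows ((List.range k).map r) (r k) (r' 0))
    (hr' : G.IsPlay r') (hf' : G.Follows (f.after ((List.range (k + 1)).map r)) r') :
    ∃ r'' : ℕ → V, G.IsPlay r'' ∧ G.Follows f r'' ∧ r'' 0 = r 0 ∧
      ∀ l, r'' (l + (k + 1)) = r' l := by
  let r'' : ℕ → V := fun l => if l ≤ k then r l else r' (l - (k + 1))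
  have hlo : ∀ l, l ≤ k → r'' l = r l := fun l hl => if_pos hl
  have hhi : ∀ l, r'' (l + (k + 1)) = r' l := fun l => by
    have : ¬ l + (k + 1) ≤ k := by omega
    simp only [r'', if_neg this, Nat.add_sub_cancel]
  have hmap : ∀ l, l ≤ k + 1 → (List.range l).map r'' = (List.range l).map r := fun l hl =>
    List.map_congr_left fun a ha => hlo a (by have := List.mem_range.mp ha; omega)
  have hall : ∀ l, f.Allows ((List.range l).map r'') (r'' l) (r'' (l + 1)) := by
    intro l
    rcases lt_trichotomy l k with hl | rfl | hl
    · rw [hmap l (by omega), hlo l hl.le, hlo (l + 1) hl]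
      exact hr l hl
    · rw [hmap l (by omega), hlo l le_rfl]
      have := hhi 0
      rw [zero_add] at this
      rw [this]
      exact hk
    · obtain ⟨a, rfl⟩ := Nat.exists_eq_add_of_le' (Nat.succ_le_of_lt hl)
      have hlist : (List.range (a + (k + 1))).map r'' =
          (List.range (k + 1)).map r ++ (List.range a).map r' := by
        rw [add_comm a, List.range_add, List.map_append, hmap _ le_rfl, List.map_map]
        congr 1
        refine List.map_congr_left fun b _ => ?_
        rw [Function.comp_apply, add_comm, hhi]
      rw [Nat.succ_eq_add_one, hlist, hhi, show a + (k + 1) + 1 = a + 1 + (k + 1) by omega, hhi]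
      exact Strategy.allows_of_follows hr' hf' a
  obtain ⟨h1, h2⟩ := Strategy.follows_of_allows hall
  exact ⟨r'', h1, h2, hlo 0 (Nat.zero_le k), hhi⟩

end GameGraph

/-! ### Correctness of the fixed point -/

namespace ModeTargetGame

variable {V : Type u} {P : Type v} {m : ℕ} {t : Fin m → ℕ} (G : ModeTargetGame V P m t)

theorem fixedPoint_eq : G.fixedPoint = nuFix (zStep G.Pre G.modeTarget G.notMode) := by
  simp only [fixedPoint, Set.union_assoc]
  rfl

theorem sat_formula (w : ℕ → Set P) : LTL.Sat w 0 G.formula ↔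
    ∀ i, (∃ k, ∀ l, k ≤ l → G.M i ∈ w l) → ∃ j, ∃ k, ∀ l, k ≤ l → G.T i j ∈ w l := by
  simp only [formula, LTL.sat_bigAnd, List.mem_ofFn, forall_exists_index,
    forall_apply_eq_imp_iff, LTL.sat_imp, LTL.sat_bigOr, exists_exists_eq_and,
    LTL.sat_ev_alw_atom]

/-- Persistence properties ignore finite prefixes; this lets a losing play be preceded by any
history. -/
theorem sat_formula_shift (w : ℕ → Set P) (d : ℕ) :
    LTL.Sat (fun k => w (k + d)) 0 G.formula ↔ LTL.Sat w 0 G.formula := by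
  have hshift : ∀ p : P, (∃ k, ∀ l, k ≤ l → p ∈ w (l + d)) ↔ ∃ k, ∀ l, k ≤ l → p ∈ w l := by
    intro p
    constructor
    · rintro ⟨k, hk⟩
      refine ⟨k + d, fun l hl => ?_⟩
      have := hk (l - d) (by omega)
      rwa [Nat.sub_add_cancel (by omega)] at this
    · rintro ⟨k, hk⟩
      exact ⟨k, fun l hl => hk _ (by omega)⟩
  simp only [sat_formula, hshift]

variable [Finite V]

/-- At the fixed point in `Z`, every mode yields the same set. -/
theorem modeFix_subset_fixedPoint (ht : ∀ i, 1 ≤ t i) (i : Fin m) :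
    modeFix G.Pre (G.modeTarget i) (G.notMode i ∩ G.Pre G.fixedPoint) ⊆ G.fixedPoint := by
  have hpre := G.monotone_Pre
  set Z := G.fixedPoint with hZ
  set Y : Fin m → Set V := fun i => modeFix G.Pre (G.modeTarget i) (G.notMode i ∩ G.Pre Z)
    with hY
  set Z' : Set V := ⋃ i, Y i with hZ'
  have hYZ' : ∀ i, Y i ⊆ Z' := fun i => Set.subset_iUnion Y i
  have hfix : zStep G.Pre G.modeTarget G.notMode Z = Z := by
    rw [hZ, fixedPoint_eq]
    exact map_nuFix (monotone_zStep hpre _ _)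
  have hZY : ∀ i, Z ⊆ Y i := fun i => by
    conv_lhs => rw [← hfix]
    exact Set.iInter_subset _ i
  -- Induction on the rounds for mode `i`. A state in mode `k` is not in mode `i`, so the target
  -- summand is void and the state can force `Z` or the previous round. A state outside mode `k`
  -- only has to force `Z'`.
  have hlayer : ∀ (i k : Fin m), i ≠ k → ∀ l,
      (yStep G.Pre (G.modeTarget i) (G.notMode i ∩ G.Pre Z))^[l] ∅ ⊆
        modeFix G.Pre (G.modeTarget k) (G.notMode k ∩ G.Pre Z') := by
    intro i k hik l
    induction l with
    | zero => exact Set.empty_subset _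
    | succ l ih =>
      intro x hx
      have hxY : x ∈ Y i := iterate_yStep_subset_modeFix _ (l + 1) hx
      rw [Function.iterate_succ_apply'] at hx
      obtain ⟨j, hj⟩ := Set.mem_iUnion.mp hx
      rw [← xStep_nuFix hpre] at hj
      apply union_pre_subset_modeFix hpre (ht k)
      by_cases hk : G.M k ∈ G.L x
      · right
        rcases hj with h | h | h
        · exact absurd hk (G.exclusive x i k hik.symm h.2.1)
        · refine hpre ((hZY k).trans ?_) h.2
          exact modeFix_subset hpre (Set.inter_subset_inter_right _
            (hpre ((hZY i).trans (hYZ' i))))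
        · exact hpre ih h
      · left
        refine ⟨hk, ?_⟩
        rcases modeFix_subset_union_pre hpre _ hxY with h | h
        · exact hpre ((hZY i).trans (hYZ' i)) h.2
        · exact hpre (hYZ' i) h
  have hpost : Z' ⊆ zStep G.Pre G.modeTarget G.notMode Z' := by
    refine Set.iUnion_subset fun i => Set.subset_iInter fun k => ?_
    by_cases hik : i = k
    · subst hik
      exact modeFix_subset hpre (Set.inter_subset_inter_right _
        (hpre ((hZY i).trans (hYZ' i))))
    · exact Set.iUnion_subset fun l => hlayer i k hik l
  refine (hYZ' i).trans ?_
  rw [hZ, fixedPoint_eq]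
  exact (subset_nuFix (monotone_zStep hpre _ _) hpost)

theorem fixedPoint_subset_winningSet (ht : ∀ i, 1 ≤ t i) :
    G.fixedPoint ⊆ G.winningSet G.formula := by
  classical
  have hpre := G.monotone_Pre
  have hmode : ∀ i, modeFix G.Pre (G.modeTarget i) (G.notMode i ∩ G.Pre G.fixedPoint) =
      G.fixedPoint := fun i => by
    refine subset_antisymm (G.modeFix_subset_fixedPoint ht i) ?_
    conv_lhs => rw [fixedPoint_eq, ← map_nuFix (monotone_zStep hpre _ _), ← fixedPoint_eq]
    exact Set.iInter_subset _ i
  choose Q τ hQ hstep using fun i =>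
    exists_layers hpre (ht i) (A := G.modeTarget i) (G.notMode i ∩ G.Pre G.fixedPoint)
  have hex : ∀ i x, x ∈ G.fixedPoint → ∃ k, x ∈ Q i k := fun i x hx => by
    rw [← hmode i, ← hQ i] at hx
    exact Set.mem_iUnion.mp hx
  let ρ : Fin m → V → ℕ := fun i x => sInf {k | x ∈ Q i k}
  have hρ : ∀ i x, x ∈ G.fixedPoint → x ∈ Q i (ρ i x) := fun i x hx => Nat.sInf_mem (hex i x hx)
  have hρle : ∀ i x k, x ∈ Q i k → ρ i x ≤ k := fun i x k h => Nat.sInf_le h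
  have hQsub : ∀ i k, Q i k ⊆ G.fixedPoint := fun i k => by
    rw [← hmode i, ← hQ i]
    exact Set.subset_iUnion (Q i) k
  -- At most one mode holds at `x`, so at most one rank is constrained; the ranks of the other modes
  -- may rise.
  let S : V → Set V := fun x => {y | y ∈ G.fixedPoint ∧ ∀ i, G.M i ∈ G.L x →
    ρ i y < ρ i x ∨ (ρ i y ≤ ρ i x ∧ x ∈ G.modeTarget i (τ i (ρ i x)))}
  have hforce : ∀ x ∈ G.fixedPoint, x ∈ G.Pre (S x) := by
    intro x hx
    by_cases hi : ∃ i, G.M i ∈ G.L x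
    · obtain ⟨i, hi⟩ := hi
      have huniq : ∀ k, G.M k ∈ G.L x → k = i := fun k hk => by
        by_contra hne
        exact G.exclusive x i k hne hi hk
      rcases hstep i _ (hρ i x hx) with h | h | h
      · refine hpre (show Q i (ρ i x) ⊆ S x from fun y hy => ⟨hQsub i _ hy, fun k hk => ?_⟩) h.1
        obtain rfl := huniq k hk
        exact Or.inr ⟨hρle _ _ _ hy, h.2⟩
      · exact absurd hi h.1
      · refine hpre (show (⋃ k' < ρ i x, Q i k') ⊆ S x from fun y hy => ?_) h
        obtain ⟨k', hk', hy⟩ := Set.mem_iUnion₂.mp hy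
        refine ⟨hQsub i _ hy, fun k hk => ?_⟩
        obtain rfl := huniq k hk
        exact Or.inl ((hρle _ _ _ hy).trans_lt hk')
    · by_cases hm : Nonempty (Fin m)
      · obtain ⟨i⟩ := hm
        have hx' := hx
        rw [← hmode i] at hx'
        have hsub : G.fixedPoint ⊆ S x := fun y hy => ⟨hy, fun k hk => (hi ⟨k, hk⟩).elim⟩
        rcases modeFix_subset_union_pre hpre _ hx' with h | h
        · exact hpre hsub h.2
        · rw [hmode i] at h
          exact hpre hsub h
      -- With no modes at all the intersection is empty and the fixed point is everything.
      · have huniv : ∀ y, y ∈ G.fixedPoint := by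
          intro y
          rw [fixedPoint_eq]
          refine subset_nuFix (monotone_zStep hpre _ _) (X := Set.univ) (fun z _ => ?_) trivial
          exact Set.mem_iInter.mpr fun i => (hm ⟨i⟩).elim
        have hS : ∀ y, y ∈ S x := fun y => ⟨huniv y, fun i => (hm ⟨i⟩).elim⟩
        rcases G.mem_V₀_or_mem_V₁ x with h | h
        · obtain ⟨y, hy⟩ := G.serial x
          exact Or.inl ⟨h, y, hS y, hy⟩
        · exact Or.inr ⟨h, fun y _ => hS y⟩
  obtain ⟨f, hf⟩ := G.exists_positional G.fixedPoint S (fun _ _ _ h => h.1) hforce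
  intro x hx
  refine ⟨f, fun r hr h0 hfol => ?_⟩
  have hplay := hf r hr (h0 ▸ hx) hfol
  rw [sat_formula]
  rintro i ⟨k, hk⟩
  have hnext : ∀ l, ρ i (r (k + l + 1)) < ρ i (r (k + l)) ∨
      (ρ i (r (k + l + 1)) ≤ ρ i (r (k + l)) ∧
        r (k + l) ∈ G.modeTarget i (τ i (ρ i (r (k + l))))) :=
    fun l => (hplay (k + l)).2.2 i (hk _ (Nat.le_add_right k l))
  have hanti : Antitone fun l => ρ i (r (k + l)) :=
    antitone_nat_of_succ_le fun l => (hnext l).elim le_of_lt And.left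
  obtain ⟨a, ha⟩ : ∃ a, ∀ l, a ≤ l → ρ i (r (k + l)) = ρ i (r (k + a)) := by
    obtain ⟨a, ha⟩ := WellFounded.has_min wellFounded_lt
      (Set.range fun l => ρ i (r (k + l))) (Set.range_nonempty _)
    obtain ⟨⟨a, rfl⟩, hmin⟩ := ha
    exact ⟨a, fun l hl => le_antisymm (hanti hl) (not_lt.mp (hmin _ ⟨l, rfl⟩))⟩
  refine ⟨τ i (ρ i (r (k + a))), k + a, fun l hl => ?_⟩
  obtain ⟨l, rfl⟩ := Nat.exists_eq_add_of_le hl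
  have h1 := ha (a + l) (by omega)
  have h2 := ha (a + l + 1) (by omega)
  rcases hnext (a + l) with h | h
  · rw [add_assoc, h1, h2] at h
    exact absurd h (lt_irrefl _)
  · have := h.2.2
    rwa [h1, ← add_assoc] at this

/-- From outside the fixed point of mode `i`, player 1 can stay outside and, as long as the play
is in mode `i`, leave the targets in turn. -/
theorem exists_play_avoiding (i : Fin m) (ht : 1 ≤ t i) (B : Set V)
    (f : G.Strategy) {x : V} (hx : x ∉ modeFix G.Pre (G.modeTarget i) B) :
    ∃ r : ℕ → V, G.IsPlay r ∧ G.Follows f r ∧ r 0 = x ∧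
      (∀ k, r k ∉ modeFix G.Pre (G.modeTarget i) B) ∧
      ((∀ k, G.M i ∈ G.L (r k)) → ∀ j k, ∃ l, k ≤ l ∧ G.T i j ∉ G.L (r l)) := by
  classical
  have hpre := G.monotone_Pre
  set Y := modeFix G.Pre (G.modeTarget i) B with hY
  -- The memory `q` counts the targets dealt with so far; `τ q` is the one to leave next. The rank
  -- `ρ j x` below is the stage at which `x` drops out of the iteration in `X` for target `j`; it
  -- exists outside `Y` because all these iterations converge to `Y`.
  let τ : ℕ → Fin (t i) := fun q => ⟨q % t i, Nat.mod_lt _ ht⟩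
  let F : Fin (t i) → Set V → Set V := fun j => xStep G.Pre (G.modeTarget i j) B Y
  let ρ : Fin (t i) → V → ℕ := fun j x => sInf {k | x ∉ (F j)^[k] Set.univ}
  have hF : ∀ j, nuFix (F j) = Y := fun j => nuFix_xStep_modeFix hpre B j
  have hpreY : ∀ x, x ∉ Y → x ∉ G.Pre Y := fun x hx h =>
    hx (union_pre_subset_modeFix hpre ht B (Or.inr h))
  have hρ : ∀ j x, x ∉ Y → x ∉ (F j)^[ρ j x] Set.univ := fun j x hx => by
    rw [← hF j] at hx
    have hex : ∃ k, x ∉ (F j)^[k] Set.univ := by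
      by_contra hno
      push Not at hno
      exact hx (Set.mem_iInter.mpr hno)
    exact Nat.sInf_mem hex
  have hstep : ∀ (h : List V) (x : V) (q : ℕ), x ∉ Y → ∃ y q', f.Allows h x y ∧ y ∉ Y ∧
      (G.M i ∈ G.L x → (G.T i (τ q) ∉ G.L x ∧ q' = q + 1) ∨
        (q' = q ∧ ρ (τ q) y < ρ (τ q) x)) := by
    intro h x q hx
    by_cases hmt : x ∈ G.modeTarget i (τ q)
    -- Inside the current target the rank is positive, and dropping out at stage `k + 1` means that
    -- player 0 cannot force the `k`-th iterate. As that iterate contains `Y`, escaping it lowers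
    -- the rank and avoids `Y`.
    · have hk := hρ (τ q) x hx
      obtain ⟨k, hk'⟩ := Nat.exists_eq_succ_of_ne_zero (n := ρ (τ q) x)
        (fun h0 => by rw [h0] at hk; exact hk trivial)
      rw [hk', Function.iterate_succ_apply'] at hk
      obtain ⟨y, hy, hall⟩ := f.exists_allows h fun hp => hk (Or.inl ⟨hp, hmt⟩)
      refine ⟨y, q, hall, fun hyY => hy ?_, fun _ => Or.inr ⟨rfl, ?_⟩⟩
      · rw [← hF (τ q)] at hyY
        exact Set.mem_iInter.mp hyY k
      · rw [hk']
        exact Nat.lt_succ_of_le (Nat.sInf_le hy)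
    -- Here either the target or the mode fails; the counter advances in both cases, but only the
    -- former matters.
    · obtain ⟨y, hy, hall⟩ := f.exists_allows h (hpreY x hx)
      exact ⟨y, q + 1, hall, hy, fun hM => Or.inl ⟨fun hT => hmt ⟨hM, hT⟩, rfl⟩⟩
  obtain ⟨r, p, hr, hf, h0, hp0, hrp⟩ := f.exists_play (fun x _ => x ∉ Y) _ hstep x 0 hx
  refine ⟨r, hr, hf, h0, fun k => (hrp k).1, fun hM j k => ?_⟩
  have hR := fun k => (hrp k).2 (hM k)
  have hpk : ∀ k, p k ≤ k := by
    intro k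
    induction k with
    | zero => exact hp0.le
    | succ k ih => rcases hR k with h | h <;> omega
  have hleave : ∀ n k, ρ (τ (p k)) (r k) = n →
      ∃ l, p l = p k ∧ p (l + 1) = p k + 1 ∧ G.T i (τ (p k)) ∉ G.L (r l) := by
    intro n
    induction n using Nat.strong_induction_on with
    | _ n ih =>
    intro k hn
    rcases hR k with h | h
    · exact ⟨k, rfl, h.2, h.1⟩
    · have := ih _ (hn ▸ h.2) (k + 1) (by rw [h.1])
      rwa [h.1] at this
  have hreach : ∀ q, ∃ k, p k = q := by
    intro q
    induction q with
    | zero => exact ⟨0, hp0⟩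
    | succ q ih =>
      obtain ⟨k, rfl⟩ := ih
      obtain ⟨l, -, hl, -⟩ := hleave _ k rfl
      exact ⟨l + 1, hl⟩
  -- The counter never exceeds the time, so the value `t i * k + j`, congruent to `j`, is only met
  -- at time `k` or later.
  obtain ⟨a, ha⟩ := hreach (t i * k + j)
  obtain ⟨l, hl, -, hT⟩ := hleave _ a rfl
  have hτ : τ (p a) = j := Fin.ext (by simp [τ, ha, Nat.mod_eq_of_lt j.2])
  rw [hτ] at hT
  refine ⟨l, ?_, hT⟩
  have := hpk l
  have := Nat.le_mul_of_pos_left k ht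
  omega

theorem winningSet_subset_zStep (ht : ∀ i, 1 ≤ t i) :
    G.winningSet G.formula ⊆ zStep G.Pre G.modeTarget G.notMode (G.winningSet G.formula) := by
  rintro x ⟨f, hf⟩
  refine Set.mem_iInter.mpr fun i => ?_
  by_contra hx
  set W := G.winningSet G.formula with hW
  obtain ⟨r, hr, hfol, h0, hY, hT⟩ := G.exists_play_avoiding i (ht i) _ f hx
  by_cases hM : ∀ k, G.M i ∈ G.L (r k)
  · obtain ⟨j, k, hk⟩ := (G.sat_formula _).mp (hf r hr h0 hfol) i ⟨0, fun l _ => hM l⟩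
    obtain ⟨l, hl, hl'⟩ := hT hM j k
    exact hl' (hk l hl)
  · push Not at hM
    obtain ⟨k, hk⟩ := hM
    -- Outside mode `i`, forcing `W` would place `r k` in the set that the play avoids.
    have hkW : r k ∉ G.Pre W := fun h =>
      hY k (union_pre_subset_modeFix G.monotone_Pre (ht i) _ (Or.inl ⟨hk, h⟩))
    obtain ⟨y, hy, hall⟩ := f.exists_allows ((List.range k).map r) hkW
    have hlose : ∃ r' : ℕ → V, G.IsPlay r' ∧ r' 0 = y ∧
        G.Follows (f.after ((List.range (k + 1)).map r)) r' ∧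
        ¬ LTL.Sat (fun k => G.L (r' k)) 0 G.formula := by
      by_contra hno
      push Not at hno
      exact hy ⟨_, hno⟩
    obtain ⟨r', hr', h0', hf', hlose⟩ := hlose
    obtain ⟨r'', hr'', hf'', h0'', hshift⟩ := GameGraph.Strategy.exists_append
      (fun l _ => GameGraph.Strategy.allows_of_follows hr hfol l) (h0' ▸ hall) hr' hf'
    have hsat := hf r'' hr'' (h0''.trans h0) hf''
    rw [← G.sat_formula_shift _ (k + 1)] at hsat
    simp only [hshift] at hsat
    exact hlose hsat

theorem winningSet_formula (ht : ∀ i, 1 ≤ t i) : G.winningSet G.formula = G.fixedPoint := by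
  refine subset_antisymm ?_ (G.fixedPoint_subset_winningSet ht)
  rw [fixedPoint_eq]
  exact subset_nuFix (monotone_zStep G.monotone_Pre _ _) (G.winningSet_subset_zStep ht)

end ModeTargetGame

end MTG

namespace MTG

/-! ### Cost of the algorithm -/

namespace Symb

theorem result_bind {α β : Type u} (a : α) (c : ℕ) (f : α → Symb β) (b : β) (d : ℕ)
    (h : f a = result b d) : (result a c >>= f) = result b (c + d) := by
  change (match f a with
    | none => none
    | some (b, d) => some (b, c + d)) = result b (c + d)
  rw [h]
  rfl

theorem bind_eq_result {α β : Type u} {x : Symb α} {f : α → Symb β} {a : α} {b : β} {c d : ℕ}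
    (hx : x = result a c) (hf : f a = result b d) : (x >>= f) = result b (c + d) := by
  rw [hx, result_bind (h := hf)]

theorem pure_eq {α : Type u} (a : α) : (pure a : Symb α) = result a 0 := rfl

end Symb

section Cost

open Symb

variable {V : Type u} {pre : Set V → Set V}

/-- `Pre` as a symbolic operation of unit cost. -/
def unitCost (pre : Set V → Set V) (S : Set V) : Symb (Set V) := result (pre S) 1

/-- Each round but the last removes a state; the `+ 1` pays for the round that detects stability. -/
theorem untilStable_halts [Finite V] {F : Set V → Set V} (hF : Monotone F) (X : Set V) (hX : F X ⊆ X)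
    (hν : nuFix F ⊆ X) :
    ∃ c, c + (nuFix F).ncard ≤ X.ncard + 1 ∧
      ∀ b, X.ncard < b → untilStable (fun X => result (F X) 1) b X = result (nuFix F) c := by
  induction hn : X.ncard using Nat.strong_induction_on generalizing X with
  | _ n ih =>
  subst hn
  by_cases h : F X = X
  · have hXν : nuFix F = X := subset_antisymm hν (subset_nuFix hF h.ge)
    refine ⟨1, by rw [hXν, add_comm], fun b hb => ?_⟩
    obtain ⟨b, rfl⟩ := Nat.exists_eq_succ_of_ne_zero (Nat.ne_zero_of_lt hb)
    rw [untilStable, result_bind (b := nuFix F) (d := 0)]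
    rw [if_pos h, hXν, pure_eq]
  · have hlt : (F X).ncard < X.ncard := Set.ncard_lt_ncard (hX.ssubset_of_ne h)
    obtain ⟨c, hc, hb'⟩ := ih _ hlt (F X) (hF hX) ((map_nuFix hF).ge.trans (hF hν)) rfl
    refine ⟨1 + c, by omega, fun b hb => ?_⟩
    obtain ⟨b, rfl⟩ := Nat.exists_eq_succ_of_ne_zero (Nat.ne_zero_of_lt hb)
    rw [untilStable, result_bind (b := nuFix F) (d := c)]
    rw [if_neg h]
    exact hb' b (by omega)

/-- The stored sets lie between the greatest fixed points that are to be computed from them and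
the full set, and shrink under the operators of these fixed points. -/
def StoreValid (pre : Set V → Set V) {t : ℕ} (A : Fin t → Set V) (B : Set V)
    (s : Fin t → ℕ → Set V) : Prop :=
  ∀ j l, nuFix (xStep pre (A j) B ((yStep pre A B)^[l] ∅)) ⊆ s j l ∧
    xStep pre (A j) B ((yStep pre A B)^[l] ∅) (s j l) ⊆ s j l

/-- Both conditions are monotone in `B`, which shrinks with `Z`; the store thus survives into the
next round in `Z`. -/
theorem StoreValid.anti (hpre : Monotone pre) {t : ℕ} {A : Fin t → Set V} {B B' : Set V}
    {s : Fin t → ℕ → Set V} (h : StoreValid pre A B s) (hB : B' ⊆ B) :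
    StoreValid pre A B' s := fun j l =>
  ⟨(nuFix_xStep_subset hpre _ hB (iterate_yStep_subset hpre hB l)).trans (h j l).1,
    (xStep_subset hpre _ hB (iterate_yStep_subset hpre hB l) subset_rfl).trans (h j l).2⟩

/-- The total size of the sets stored for the rounds up to `card V`. -/
noncomputable def storeSize {t : ℕ} (s : Fin t → ℕ → Set V) : ℕ :=
  ∑ j, ∑ l ∈ Finset.range (Nat.card V + 1), (s j l).ncard

theorem storeSize_update {t : ℕ} (s : Fin t → ℕ → Set V) (j : Fin t) (l : ℕ)
    (hl : l ≤ Nat.card V) (X : Set V) :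
    storeSize (Function.update s j (Function.update (s j) l X)) + (s j l).ncard =
      storeSize s + X.ncard := by
  classical
  have hl' : l ∈ Finset.range (Nat.card V + 1) := Finset.mem_range.mpr (by omega)
  unfold storeSize
  rw [← Finset.add_sum_erase _ _ (Finset.mem_univ j),
    ← Finset.add_sum_erase (a := j) _ (fun j => ∑ l ∈ _, (s j l).ncard) (Finset.mem_univ j),
    ← Finset.add_sum_erase _ _ hl', ← Finset.add_sum_erase _ (fun l => (s j l).ncard) hl']
  have h1 : ∑ x ∈ Finset.univ.erase j, ∑ l' ∈ Finset.range (Nat.card V + 1),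
      (Function.update s j (Function.update (s j) l X) x l').ncard =
      ∑ x ∈ Finset.univ.erase j, ∑ l' ∈ Finset.range (Nat.card V + 1), (s x l').ncard :=
    Finset.sum_congr rfl fun x hx => by rw [Function.update_of_ne (Finset.ne_of_mem_erase hx)]
  have h2 : ∑ x ∈ (Finset.range (Nat.card V + 1)).erase l,
      (Function.update s j (Function.update (s j) l X) j x).ncard =
      ∑ x ∈ (Finset.range (Nat.card V + 1)).erase l, (s j x).ncard :=
    Finset.sum_congr rfl fun x hx => by
      rw [Function.update_self, Function.update_of_ne (Finset.ne_of_mem_erase hx)]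
  rw [h1, h2]
  simp only [Function.update_self]
  omega

/-- The decrease of the store pays for all `Pre` computations except one per target. -/
theorem targetPass_halts [Finite V] (hpre : Monotone pre) {t : ℕ} (A : Fin t → Set V) (B : Set V) (l : ℕ)
    (hl : l ≤ Nat.card V) (s : Fin t → ℕ → Set V) (hs : StoreValid pre A B s) :
    ∃ s' c, StoreValid pre A B s' ∧ c + storeSize s' ≤ storeSize s + t ∧
      ∀ N, Nat.card V < N →
        targetPass N (unitCost pre) A (B ∪ pre ((yStep pre A B)^[l] ∅)) l s =
          result ((yStep pre A B)^[l + 1] ∅, s') c := by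
  have key : ∀ (js : List (Fin t)) (U : Set V) (s : Fin t → ℕ → Set V), StoreValid pre A B s →
      ∃ s' c, StoreValid pre A B s' ∧ c + storeSize s' ≤ storeSize s + js.length ∧
      ∀ N, Nat.card V < N →
        js.foldlM
          (fun (acc : Set V × (Fin t → ℕ → Set V)) j => do
            let X ← untilStable (fun X => do
              return ((← unitCost pre X) ∩ A j) ∪ (B ∪ pre ((yStep pre A B)^[l] ∅))) N (acc.2 j l)
            return (acc.1 ∪ X, Function.update acc.2 j (Function.update (acc.2 j) l X)))
          (U, s) =
        result (U ∪ ⋃ j ∈ js, nuFix (xStep pre (A j) B ((yStep pre A B)^[l] ∅)), s') c := by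
    intro js
    induction js with
    | nil =>
      intro U s hs
      refine ⟨s, 0, hs, by simp, fun N _ => ?_⟩
      simp [pure_eq]
    | cons j js ih =>
      intro U s hs
      set F := xStep pre (A j) B ((yStep pre A B)^[l] ∅) with hFdef
      have hF : Monotone F := monotone_xStep hpre _ _ _
      obtain ⟨c, hc, hcN⟩ := untilStable_halts hF (s j l) (hs j l).2 (hs j l).1
      have hs₁ : StoreValid pre A B
          (Function.update s j (Function.update (s j) l (nuFix F))) := by
        intro j' l'
        by_cases hj : j' = j
        · subst hj
          by_cases hl' : l' = l
          · subst hl'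
            simp only [Function.update_self]
            exact ⟨subset_rfl, (map_nuFix hF).le⟩
          · simp only [Function.update_self, Function.update_of_ne hl']
            exact hs j' l'
        · simp only [Function.update_of_ne hj]
          exact hs j' l'
      obtain ⟨s', c', hs', hc', hN'⟩ := ih (U ∪ nuFix F) _ hs₁
      refine ⟨s', c + c', hs', ?_, fun N hN => ?_⟩
      · have := storeSize_update s j l hl (nuFix F)
        rw [List.length_cons]
        omega
      · rw [List.foldlM_cons]
        have hcard : (s j l).ncard < N := lt_of_le_of_lt (Set.ncard_le_card _) hN
        refine (bind_eq_result (c := c) (bind_eq_result (d := 0) (hcN N hcard) rfl)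
          (hN' N hN)).trans ?_
        congr 2
        simp [Set.union_assoc, hFdef]
  obtain ⟨s', c, hs', hc, hN⟩ := key (List.finRange t) ∅ s hs
  refine ⟨s', c, hs', by simpa using hc, fun N h => ?_⟩
  rw [targetPass, hN N h, Function.iterate_succ_apply']
  simp [yStep]

theorem yLoop_halts [Finite V] (hpre : Monotone pre) {t : ℕ} (A : Fin t → Set V) (B : Set V)
    (s : Fin t → ℕ → Set V) (hs : StoreValid pre A B s) :
    ∃ s' c, StoreValid pre A B s' ∧
      c + storeSize s' ≤ storeSize s + (Nat.card V + 1) * (1 + t) ∧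
      ∀ N, Nat.card V < N →
        yLoop N (unitCost pre) A B N 0 ∅ s = result (modeFix pre A B, s') c := by
  -- The iterates in `Y` grow strictly until stable, so round `l` starts with at least `l` states.
  -- Hence `l ≤ card V`, the range counted by `storeSize`, and at most `d + 1` rounds remain, each
  -- adding `1 + t` to the amortized cost.
  have key : ∀ (d l : ℕ) (s : Fin t → ℕ → Set V), StoreValid pre A B s →
      l + d = Nat.card V → l ≤ ((yStep pre A B)^[l] ∅).ncard →
      ∃ s' c, StoreValid pre A B s' ∧ c + storeSize s' ≤ storeSize s + (d + 1) * (1 + t) ∧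
      ∀ N b, Nat.card V < N → d < b →
        yLoop N (unitCost pre) A B b l ((yStep pre A B)^[l] ∅) s =
          result (modeFix pre A B, s') c := by
    intro d
    induction d using Nat.strong_induction_on with
    | _ d ih =>
    intro l s hs hl hcard
    obtain ⟨s₁, c₁, hs₁, hc₁, hN₁⟩ := targetPass_halts hpre A B l (by omega) s hs
    by_cases hstable : (yStep pre A B)^[l + 1] ∅ = (yStep pre A B)^[l] ∅
    · have hfix : modeFix pre A B = (yStep pre A B)^[l] ∅ := by
        refine subset_antisymm ?_ (iterate_yStep_subset_modeFix B l)
        refine muFix_subset (monotone_yStep hpre B) ?_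
        rw [← Function.iterate_succ_apply' (yStep pre A B)]
        exact hstable.le
      refine ⟨s₁, 1 + c₁, hs₁, ?_, fun N b hN hb => ?_⟩
      · nlinarith [Nat.zero_le (d * (1 + t))]
      · obtain ⟨b, rfl⟩ := Nat.exists_eq_succ_of_ne_zero (Nat.ne_zero_of_lt hb)
        rw [yLoop, unitCost, result_bind (b := (modeFix pre A B, s₁)) (d := c₁)]
        rw [hN₁ N hN, result_bind (b := (modeFix pre A B, s₁)) (d := 0), add_zero]
        rw [if_pos hstable, hfix, pure_eq]
    · have hlt : l < ((yStep pre A B)^[l + 1] ∅).ncard :=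
        lt_of_le_of_lt hcard (Set.ncard_lt_ncard
          ((monotone_iterate_yStep hpre B (Nat.le_succ l)).ssubset_of_ne (Ne.symm hstable)))
      have hle : ((yStep pre A B)^[l + 1] ∅).ncard ≤ Nat.card V := Set.ncard_le_card _
      obtain ⟨d, rfl⟩ := Nat.exists_eq_succ_of_ne_zero (n := d) (by omega)
      obtain ⟨s', c, hs', hc, hN⟩ := ih d (Nat.lt_succ_self d) (l + 1) s₁ hs₁ (by omega) hlt
      refine ⟨s', 1 + (c₁ + c), hs', ?_, fun N b hN' hb => ?_⟩
      · nlinarith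
      · obtain ⟨b, rfl⟩ := Nat.exists_eq_succ_of_ne_zero (Nat.ne_zero_of_lt hb)
        rw [yLoop, unitCost, result_bind (b := (modeFix pre A B, s')) (d := c₁ + c)]
        rw [hN₁ N hN', result_bind (b := (modeFix pre A B, s')) (d := c)]
        rw [if_neg hstable]
        exact hN N b hN' (by omega)
  exact (key (Nat.card V) 0 s hs (zero_add _) (Nat.zero_le _)).imp fun s' => 
    Exists.imp fun c ⟨h1, h2, h3⟩ => ⟨h1, h2, fun N hN => h3 N N hN hN⟩

/-- The total size of the sets stored for all modes. -/
noncomputable def totalSize {m : ℕ} {t : Fin m → ℕ}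
    (s : (i : Fin m) → Fin (t i) → ℕ → Set V) : ℕ :=
  ∑ i, storeSize (s i)

theorem totalSize_update {m : ℕ} {t : Fin m → ℕ} (s : (i : Fin m) → Fin (t i) → ℕ → Set V)
    (i : Fin m) (x : Fin (t i) → ℕ → Set V) :
    totalSize (Function.update s i x) + storeSize (s i) = totalSize s + storeSize x := by
  unfold totalSize
  rw [← Finset.add_sum_erase _ _ (Finset.mem_univ i),
    ← Finset.add_sum_erase (a := i) _ (fun i => storeSize (s i)) (Finset.mem_univ i)]
  have h : ∑ k ∈ Finset.univ.erase i, storeSize (Function.update s i x k) =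
      ∑ k ∈ Finset.univ.erase i, storeSize (s k) :=
    Finset.sum_congr rfl fun k hk => by rw [Function.update_of_ne (Finset.ne_of_mem_erase hk)]
  rw [h, Function.update_self]
  omega

theorem modePass_halts [Finite V] (hpre : Monotone pre) {m : ℕ} {t : Fin m → ℕ}
    (A : (i : Fin m) → Fin (t i) → Set V) (D : Fin m → Set V) (Z : Set V)
    (s : (i : Fin m) → Fin (t i) → ℕ → Set V)
    (hs : ∀ i, StoreValid pre (A i) (D i ∩ pre Z) (s i)) :
    ∃ s' c, (∀ i, StoreValid pre (A i) (D i ∩ pre Z) (s' i)) ∧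
      c + totalSize s' ≤ totalSize s + ∑ i, (1 + (Nat.card V + 1) * (1 + t i)) ∧
      ∀ N, Nat.card V < N →
        modePass N (unitCost pre) A D Z s = result (zStep pre A D Z, s') c := by
  have key : ∀ (is : List (Fin m)) (U : Set V) (s : (i : Fin m) → Fin (t i) → ℕ → Set V),
      (∀ i, StoreValid pre (A i) (D i ∩ pre Z) (s i)) →
      ∃ s' c, (∀ i, StoreValid pre (A i) (D i ∩ pre Z) (s' i)) ∧
        c + totalSize s' ≤
          totalSize s + (is.map fun i => 1 + (Nat.card V + 1) * (1 + t i)).sum ∧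
        ∀ N, Nat.card V < N →
          is.foldlM
            (fun (acc : Set V × ((i : Fin m) → Fin (t i) → ℕ → Set V)) i => do
              let preZ ← unitCost pre Z
              let out ← yLoop N (unitCost pre) (A i) (D i ∩ preZ) N 0 ∅ (acc.2 i)
              return (acc.1 ∩ out.1, Function.update acc.2 i out.2))
            (U, s) =
          result (U ∩ ⋂ i ∈ is, modeFix pre (A i) (D i ∩ pre Z), s') c := by
    intro is
    induction is with
    | nil =>
      intro U s hs
      refine ⟨s, 0, hs, by simp, fun N _ => ?_⟩
      simp [pure_eq]
    | cons i is ih =>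
      intro U s hs
      obtain ⟨x, c, hx, hc, hN⟩ := yLoop_halts hpre (A i) (D i ∩ pre Z) (s i) (hs i)
      have hs₁ : ∀ k, StoreValid pre (A k) (D k ∩ pre Z) (Function.update s i x k) := by
        intro k
        by_cases hk : k = i
        · subst hk
          rwa [Function.update_self]
        · rw [Function.update_of_ne hk]
          exact hs k
      obtain ⟨s', c', hs', hc', hN'⟩ := ih (U ∩ modeFix pre (A i) (D i ∩ pre Z)) _ hs₁
      refine ⟨s', 1 + c + c', hs', ?_, fun N h => ?_⟩
      · have := totalSize_update s i x
        rw [List.map_cons, List.sum_cons]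
        omega
      · rw [List.foldlM_cons]
        refine (bind_eq_result (c := 1 + c) (bind_eq_result (c := 1) (d := c) rfl
          (bind_eq_result (d := 0) (hN N h) rfl)) (hN' N h)).trans ?_
        congr 2
        simp [Set.inter_assoc]
  obtain ⟨s', c, hs', hc, hN⟩ := key (List.finRange m) Set.univ s hs
  refine ⟨s', c, hs', ?_, fun N h => ?_⟩
  · rwa [← List.ofFn_eq_map, List.sum_ofFn] at hc
  · rw [modePass, hN N h]
    simp [zStep]

theorem algorithmMT_halts [Finite V] (hpre : Monotone pre) {m : ℕ} {t : Fin m → ℕ}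
    (A : (i : Fin m) → Fin (t i) → Set V) (D : Fin m → Set V) :
    ∃ c, c ≤ (Nat.card V + 1) * ∑ i, (1 + (Nat.card V + 1) * (1 + t i)) +
        ∑ i, t i * ((Nat.card V + 1) * Nat.card V) ∧
      HaltsWith (algorithmMT (unitCost pre) A D) (nuFix (zStep pre A D)) c := by
  set R := ∑ i, (1 + (Nat.card V + 1) * (1 + t i)) with hR
  have hmono := monotone_zStep hpre A D
  -- Induction on the size of `Z`, which drops in every round but the last; the potential left by
  -- one round is handed to the next.
  have key : ∀ (n : ℕ) (Z : Set V) (s : (i : Fin m) → Fin (t i) → ℕ → Set V), Z.ncard = n →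
      zStep pre A D Z ⊆ Z → nuFix (zStep pre A D) ⊆ Z →
      (∀ i, StoreValid pre (A i) (D i ∩ pre Z) (s i)) →
      ∃ c, c ≤ totalSize s + (n + 1) * R ∧ ∀ N b, Nat.card V < N → n < b →
        zLoop N (unitCost pre) A D b Z s = result (nuFix (zStep pre A D)) c := by
    intro n
    induction n using Nat.strong_induction_on with
    | _ n ih =>
    intro Z s hn hZ hν hs
    obtain ⟨s₁, c₁, hs₁, hc₁, hN₁⟩ := modePass_halts hpre A D Z s hs
    rw [← hR] at hc₁
    by_cases hstable : zStep pre A D Z = Z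
    · have hfix : nuFix (zStep pre A D) = Z := subset_antisymm hν (subset_nuFix hmono hstable.ge)
      refine ⟨c₁, by nlinarith [Nat.zero_le (n * R)], fun N b hN hb => ?_⟩
      obtain ⟨b, rfl⟩ := Nat.exists_eq_succ_of_ne_zero (Nat.ne_zero_of_lt hb)
      rw [zLoop, hN₁ N hN, result_bind (b := nuFix (zStep pre A D)) (d := 0), add_zero]
      rw [if_pos hstable, hfix, pure_eq]
    · have hlt : (zStep pre A D Z).ncard < n :=
        hn ▸ Set.ncard_lt_ncard (hZ.ssubset_of_ne hstable)
      obtain ⟨c, hc, hN⟩ := ih _ hlt (zStep pre A D Z) s₁ rfl (hmono hZ)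
        ((map_nuFix hmono).ge.trans (hmono hν))
        fun i => (hs₁ i).anti hpre (Set.inter_subset_inter_right _ (hpre hZ))
      refine ⟨c₁ + c, ?_, fun N b hN' hb => ?_⟩
      · nlinarith [Nat.mul_le_mul_right R hlt]
      · obtain ⟨b, rfl⟩ := Nat.exists_eq_succ_of_ne_zero (Nat.ne_zero_of_lt hb)
        rw [zLoop, hN₁ N hN', result_bind (b := nuFix (zStep pre A D)) (d := c)]
        rw [if_neg hstable]
        exact hN N b hN' (by omega)
  obtain ⟨c, hc, hN⟩ := key _ Set.univ (fun _ _ _ => Set.univ) rfl (Set.subset_univ _)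
    (Set.subset_univ _) fun _ _ _ => ⟨Set.subset_univ _, Set.subset_univ _⟩
  rw [Set.ncard_univ] at hc hN
  refine ⟨c, ?_, Nat.card V + 1, fun N h => hN N N h h⟩
  have hsize : totalSize (fun (i : Fin m) (_ : Fin (t i)) (_ : ℕ) => (Set.univ : Set V)) =
      ∑ i, t i * ((Nat.card V + 1) * Nat.card V) := by
    simp [totalSize, storeSize, Set.ncard_univ]
  omega

end Cost

end MTG

theorem theorem2 :
    ∃ C : ℕ, ∀ (V : Type u) [Fintype V] [Nonempty V] (P : Type v) (m : ℕ) (t : Fin m → ℕ)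
      (G : MTG.ModeTargetGame V P m t), (∀ i, 1 ≤ t i) →
      G.winningSet G.formula = G.fixedPoint ∧
      ∃ c : ℕ, c ≤ C * ∑ i, t i * Fintype.card V ^ 2 ∧
        MTG.Symb.HaltsWith G.runMT (G.winningSet G.formula) c := by
  -- For `n = t i = 1` the summand of the bound is `2 * (1 + 2 * 2) + 2 = 12`; the comparison is
  -- made mode by mode, using `n ≥ 1` and `t i ≥ 1`.
  refine ⟨12, fun V _ _ P m t G ht => ⟨G.winningSet_formula ht, ?_⟩⟩
  obtain ⟨c, hc, hhalt⟩ := MTG.algorithmMT_halts G.monotone_Pre G.modeTarget G.notMode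
  refine ⟨c, hc.trans ?_, ?_⟩
  · rw [Nat.card_eq_fintype_card]
    have hn : 1 ≤ Fintype.card V := Fintype.card_pos
    generalize Fintype.card V = n at hn
    rw [Finset.mul_sum, Finset.mul_sum, ← Finset.sum_add_distrib]
    refine Finset.sum_le_sum fun i _ => ?_
    obtain ⟨a, rfl⟩ := Nat.exists_eq_add_of_le hn
    obtain ⟨b, hb⟩ := Nat.exists_eq_add_of_le (ht i)
    rw [hb]
    ring_nf
    nlinarith [Nat.zero_le (a * b), Nat.zero_le (a ^ 2 * b), Nat.zero_le a, Nat.zero_le b,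
      Nat.zero_le (a ^ 2)]
  · rw [G.winningSet_formula ht, G.fixedPoint_eq]
    exact hhalt
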